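/- **Theorem 1 (Existence of Mixed-Strategy LLM-Nash Reasoning Equilibrium).** Let $\mathcal{A},\mathcal{D}$ be measurable action spaces of two players $A,D$ with payoff functions $u_A,u_D:\mathcal{A}\times\mathcal{D}\to\mathbb{R}$. Let $\mathcal{I}_A,\mathcal{I}_D$ be their information sets, $\Xi$ a set of model parameters, and $\mathcal{X},\mathcal{Y}$ nonempty finite sets of prompts available to $A$ and $D$, respectively. Let $\tilde\gamma_A:\mathcal{I}_A\times\mathcal{X}\times\Xi\to\Delta(\mathcal{A})$ and $\tilde\gamma_D:\mathcal{I}_D\times\mathcal{Y}\times\Xi\to\Delta(\mathcal{D})$ be fixed (LLM-induced) policies, where $\Delta(\cdot)$ denotes the set of probability distributions. Fix $I_A\in\mathcal{I}_A$, $I_D\in\mathcal{I}_D$ and $\theta,\delta\in\Xi$. For $x\in\mathcal{X}$, $y\in\mathcal{Y}$ and $i\in\{A,D\}$ let \[ U_i(x,y):=\mathbb{E}_{a\sim\tilde\gamma_A(\cdot\mid I_A,x,\theta),\ d\sim\tilde\gamma_D(\cdot\mid I_D,y,\delta)}[u_i(a,d)], \] with $a$ and $d$ drawn independently, and suppose that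 $u_A$ and $u_D$ are integrable under each of these joint distributions (this is automatic if $\mathcal{A}$ and $\mathcal{D}$ are finite and all of their subsets are measurable). Then there exists a pair $(\sigma_A^*,\sigma_D^*)\in\Delta(\mathcal{X})\times\Delta(\mathcal{Y})$ such that \[ \mathbb{E}_{x\sim\sigma_A^*,\,y\sim\sigma_D^*}[U_A(x,y)]\ \ge\ \mathbb{E}_{x\sim\sigma_A,\,y\sim\sigma_D^*}[U_A(x,y)]\qquad\text{for all }\sigma_A\in\Delta(\mathcal{X}), \] \[ \mathbb{E}_{x\sim\sigma_A^*,\,y\sim\sigma_D^*}[U_D(x,y)]\ \ge\ \mathbb{E}_{x\sim\sigma_A^*,\,y\sim\sigma_D}[U_D(x,y)]\qquad\text{for all }\sigma_D\in\Delta(\mathcal{Y}), \] where in every expectation $x$ and $y$ are drawn independently. -/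

import Mathlib

open MeasureTheory

namespace LLMNash

/-- An LLM-Nash game between players `A` and `D`. `ActA`, `ActD` are the action spaces,
`InfA`, `InfD` the information spaces, `X`, `Y` the prompt sets and `Ξ` the set of worldviews
(LLM parameters). The LLM policies `policyA`, `policyD` are arbitrary fixed maps sending
(information, prompt, worldview) to a probability distribution over actions. -/
structure Game (ActA ActD InfA InfD X Y Ξ : Type*)
    [MeasurableSpace ActA] [MeasurableSpace ActD] where
  /-- payoff of player `A` -/
  payoffA : ActA → ActD → ℝ
  /-- payoff of player `D` -/
  payoffD : ActA → ActD → ℝ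
  /-- the action distribution generated by the LLM of player `A` -/
  policyA : InfA → X → Ξ → ProbabilityMeasure ActA
  /-- the action distribution generated by the LLM of player `D` -/
  policyD : InfD → Y → Ξ → ProbabilityMeasure ActD

section

variable {ActA ActD InfA InfD X Y Ξ : Type*} [MeasurableSpace ActA] [MeasurableSpace ActD]

/-- The joint law of the actions `(a, d)`: `a` and `d` are drawn independently from the action
distributions that the two LLMs generate for the prompts `x` and `y`. -/
noncomputable def Game.actionLaw (G : Game ActA ActD InfA InfD X Y Ξ)
    (iA : InfA) (iD : InfD) (θ δ : Ξ) (x : X) (y : Y) : Measure (ActA × ActD) :=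
  (G.policyA iA x θ : Measure ActA).prod (G.policyD iD y δ : Measure ActD)

/-- The prompt-level payoff `U_A(x, y)`. -/
noncomputable def Game.promptPayoffA (G : Game ActA ActD InfA InfD X Y Ξ)
    (iA : InfA) (iD : InfD) (θ δ : Ξ) (x : X) (y : Y) : ℝ :=
  ∫ p, G.payoffA p.1 p.2 ∂(G.actionLaw iA iD θ δ x y)

/-- The prompt-level payoff `U_D(x, y)`. -/
noncomputable def Game.promptPayoffD (G : Game ActA ActD InfA InfD X Y Ξ)
    (iA : InfA) (iD : InfD) (θ δ : Ξ) (x : X) (y : Y) : ℝ :=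
  ∫ p, G.payoffD p.1 p.2 ∂(G.actionLaw iA iD θ δ x y)

/-- Both expected utilities are well defined (the payoffs are integrable) for every pair of
prompts. This is automatic for finite action sets in which all subsets are measurable. -/
def Game.HasExpectedUtilities (G : Game ActA ActD InfA InfD X Y Ξ)
    (iA : InfA) (iD : InfD) (θ δ : Ξ) : Prop :=
  ∀ (x : X) (y : Y),
    Integrable (fun p : ActA × ActD => G.payoffA p.1 p.2) (G.actionLaw iA iD θ δ x y) ∧
    Integrable (fun p : ActA × ActD => G.payoffD p.1 p.2) (G.actionLaw iA iD θ δ x y)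

/-- The expectation of `U(x, y)` for independent `x ∼ σ` and `y ∼ τ`, where `σ`, `τ` are
probability vectors on the finite sets `X`, `Y`. -/
noncomputable def mixedPayoff [Fintype X] [Fintype Y] (U : X → Y → ℝ)
    (σ : X → ℝ) (τ : Y → ℝ) : ℝ :=
  ∑ x, ∑ y, σ x * τ y * U x y

/-- `(σ, τ) ∈ Δ(X) × Δ(Y)` is a mixed-strategy LLM-Nash reasoning equilibrium. -/
def Game.IsMixedReasoningEquilibrium [Fintype X] [Fintype Y]
    (G : Game ActA ActD InfA InfD X Y Ξ) (iA : InfA) (iD : InfD) (θ δ : Ξ)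
    (σ : X → ℝ) (τ : Y → ℝ) : Prop :=
  σ ∈ stdSimplex ℝ X ∧ τ ∈ stdSimplex ℝ Y ∧
  (∀ σ' ∈ stdSimplex ℝ X,
    mixedPayoff (G.promptPayoffA iA iD θ δ) σ' τ ≤
      mixedPayoff (G.promptPayoffA iA iD θ δ) σ τ) ∧
  (∀ τ' ∈ stdSimplex ℝ Y,
    mixedPayoff (G.promptPayoffD iA iD θ δ) σ τ' ≤
      mixedPayoff (G.promptPayoffD iA iD θ δ) σ τ)

end

end LLMNash

/-! An equilibrium is a solution of a variational inequality on the product of the two simplices: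
the field of expected payoffs of pure prompts is linear, and its inner product with a displacement
is the sum of the two unilateral deviation gains (`exists_mixed_equilibrium`). Such a solution is a
fixed point of `z ↦ P (z + F z)` with `P` the nearest-point projection. This map is Lipschitz, so
Brouwer's theorem is needed only for Lipschitz maps.

Brouwer follows from the absence of a Lipschitz retraction, proved by integrating Jacobians. If `g`
vanishes outside a ball, `x + t • g x` permutes the ball for small `t`, so the integral of `det (1 +
t • Dg)` is the volume of the ball. The integrand is polynomial in `t`, so this persists at `t = 1`.
For a map sending the ball into its sphere, that determinant vanishes almost everywhere, a
contradiction. -/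

section JacobianOfLipschitzPerturbation

open Metric Set Module
open scoped NNReal ENNReal RealInnerProductSpace

/-! ### Determinants along the line `1 + t • A` -/

section DetPolynomial

variable {E : Type*} [NormedAddCommGroup E] [NormedSpace ℝ E] [FiniteDimensional ℝ E]

/-- The determinant of `1 + t • A` is a polynomial in `t` of degree at most the dimension. -/
theorem ContinuousLinearMap.exists_polynomial_eval_eq_det_one_add_smul (A : E →L[ℝ] E) :
    ∃ p : Polynomial ℝ, p.natDegree ≤ finrank ℝ E ∧
      ∀ t : ℝ, p.eval t = (1 + t • A).det := by
  classical
  set b := finBasis ℝ E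
  set M := LinearMap.toMatrix b b (A : E →ₗ[ℝ] E)
  refine ⟨((Polynomial.X : Polynomial ℝ) • M.map Polynomial.C +
      (1 : Matrix _ _ ℝ).map Polynomial.C).det, ?_, fun t => ?_⟩
  · simpa using Polynomial.natDegree_det_X_add_C_le M 1
  · have hA : (((1 + t • A : E →L[ℝ] E)) : E →ₗ[ℝ] E) = 1 + t • (A : E →ₗ[ℝ] E) := rfl
    rw [ContinuousLinearMap.det, hA, ← LinearMap.det_toMatrix b, map_add, map_smul,
      LinearMap.toMatrix_one, ← Polynomial.coe_evalRingHom, RingHom.map_det]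
    congr 1
    ext i j
    simp [M, Matrix.map_apply, Matrix.one_apply, apply_ite, add_comm]
    ring

/-- Every `1 + s • A` with `s ∈ [0, 1]` is invertible by the Neumann series, so the determinant
cannot change sign from its value `1` at `s = 0`. -/
theorem ContinuousLinearMap.det_one_add_pos_of_norm_lt_one {A : E →L[ℝ] E} (hA : ‖A‖ < 1) :
    0 < (1 + A).det := by
  have hne : ∀ s ∈ Icc (0 : ℝ) 1, (1 + s • A).det ≠ 0 := by
    intro s hs
    have h1 : ‖-(s • A)‖ < 1 := by
      rw [norm_neg, norm_smul, Real.norm_of_nonneg hs.1]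
      nlinarith [hs.1, hs.2, norm_nonneg A]
    have h2 : IsUnit (1 + s • A) := by
      simpa using isUnit_one_sub_of_norm_lt_one h1
    have h3 := (h2.map (ContinuousLinearMap.toLinearMapRingHom (R₁ := ℝ) (M₁ := E)))
    exact ((LinearMap.isUnit_iff_isUnit_det _).1 h3).ne_zero
  have hc : ContinuousOn (fun s : ℝ => (1 + s • A).det) (Icc 0 1) :=
    (ContinuousLinearMap.continuous_det.comp (by fun_prop)).continuousOn
  by_contra! hneg
  obtain ⟨s, hs, h0⟩ := intermediate_value_Icc' zero_le_one hc
    (show (0 : ℝ) ∈ Icc _ _ by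
      constructor
      · simpa using hneg
      · simp [ContinuousLinearMap.det])
  exact hne s hs h0

/-- Extrapolation from small parameters to parameter `1`. -/
theorem exists_extrapolation_weights (n : ℕ) {ε : ℝ} (hε : 0 < ε) :
    ∃ (t w : ℕ → ℝ), (∀ i, 0 < t i ∧ t i ≤ ε) ∧
      ∀ p : Polynomial ℝ, p.natDegree ≤ n →
        p.eval 1 = ∑ i ∈ Finset.range (n + 1), w i * p.eval (t i) := by
  classical
  set t : ℕ → ℝ := fun i => ε / (i + 1)
  have ht : Function.Injective t := by
    intro i j hij
    simp only [t] at hij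
    field_simp at hij
    exact_mod_cast (by linarith : (i : ℝ) = j)
  refine ⟨t, fun i => (Lagrange.basis (Finset.range (n + 1)) t i).eval 1, fun i => ⟨by positivity,
    div_le_self hε.le (by linarith [Nat.cast_nonneg (α := ℝ) i])⟩, fun p hp => ?_⟩
  have h := Lagrange.eq_interpolate (s := Finset.range (n + 1)) (v := t) (f := p) ht.injOn
    (by
      rw [Finset.card_range]
      exact (Polynomial.degree_le_natDegree).trans_lt (by exact_mod_cast Nat.lt_succ_of_le hp))
  conv_lhs => rw [h]
  rw [Lagrange.interpolate_apply, Polynomial.eval_finsetSum]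
  simp [mul_comm]

end DetPolynomial

/-! ### The Jacobian integral of a Lipschitz perturbation of the identity -/

section Perturbation

variable {E : Type*} [NormedAddCommGroup E] [NormedSpace ℝ E] [FiniteDimensional ℝ E]
  {g : E → E} {L : ℝ≥0} {R : ℝ}

theorem LipschitzWith.bijective_add_smul (hg : LipschitzWith L g) {t : ℝ≥0} (ht : t * L < 1) :
    Function.Bijective fun x => x + (t : ℝ) • g x := by
  have : CompleteSpace E := FiniteDimensional.complete ℝ E
  have happ : ApproximatesLinearOn (fun x => x + (t : ℝ) • g x)
      ((ContinuousLinearEquiv.refl ℝ E : E ≃L[ℝ] E) : E →L[ℝ] E) univ (t * L) := by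
    intro x _ y _
    have : x + (t : ℝ) • g x - (y + (t : ℝ) • g y) -
        ((ContinuousLinearEquiv.refl ℝ E : E ≃L[ℝ] E) : E →L[ℝ] E) (x - y)
        = (t : ℝ) • (g x - g y) := by
      simp [smul_sub]; abel
    rw [this, norm_smul, NNReal.norm_eq, NNReal.coe_mul, mul_assoc]
    exact mul_le_mul_of_nonneg_left (hg.norm_sub_le x y) t.2
  have hc : Subsingleton E ∨
      t * L < ‖((ContinuousLinearEquiv.refl ℝ E).symm : E →L[ℝ] E)‖₊⁻¹ := by
    rcases subsingleton_or_nontrivial E with h | h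
    · exact .inl h
    · right
      simpa using ht
  exact ⟨injOn_univ.1 (happ.injOn hc), happ.surjective hc⟩

/-- A bijection of the space that fixes every point outside the ball must permute the ball. -/
theorem LipschitzWith.add_smul_image_closedBall (hg : LipschitzWith L g)
    (hout : ∀ x, R < ‖x‖ → g x = 0) {t : ℝ≥0} (ht : t * L < 1) :
    (fun x => x + (t : ℝ) • g x) '' closedBall 0 R = closedBall 0 R := by
  obtain ⟨hinj, hsurj⟩ := hg.bijective_add_smul ht
  have hfix : ∀ x, R < ‖x‖ → x + (t : ℝ) • g x = x := fun x hx => by simp [hout x hx]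
  apply Subset.antisymm
  · rintro _ ⟨x, hx, rfl⟩
    by_contra hy
    simp only [mem_closedBall_zero_iff, not_le] at hx hy
    have := hinj (hfix _ hy)
    simp only at this
    rw [this] at hy
    linarith
  · intro y hy
    obtain ⟨x, rfl⟩ := hsurj y
    refine ⟨x, ?_, rfl⟩
    by_contra hx
    simp only [mem_closedBall_zero_iff, not_le] at hx hy
    rw [hfix x hx] at hy
    linarith

variable [MeasurableSpace E] [BorelSpace E]

/-- Passing to Hausdorff measure gives the claim. It lets the change of variables ignore the points
where `g` is not differentiable. -/
theorem LipschitzWith.addHaar_image_eq_zero (μ : Measure E) [μ.IsAddHaarMeasure]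
    {f : E → E} {C : ℝ≥0} (hf : LipschitzWith C f) {s : Set E} (hs : μ s = 0) :
    μ (f '' s) = 0 := by
  have h1 : (Measure.hausdorffMeasure (finrank ℝ E) : Measure E) s = 0 :=
    Measure.absolutelyContinuous_isAddHaarMeasure _ μ hs
  refine Measure.absolutelyContinuous_isAddHaarMeasure μ
    (Measure.hausdorffMeasure (finrank ℝ E)) (le_antisymm ?_ bot_le)
  refine (hf.hausdorffMeasure_image_le (Nat.cast_nonneg _) s).trans ?_
  simp [h1]

theorem LipschitzWith.integrableOn_det_one_add_smul_fderiv (μ : Measure E) [μ.IsAddHaarMeasure]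
    (hg : LipschitzWith L g) (t : ℝ) :
    IntegrableOn (fun x => (1 + t • fderiv ℝ g x).det) (closedBall 0 R) μ := by
  have hmeas : Measurable fun x => (1 + t • fderiv ℝ g x).det :=
    (ContinuousLinearMap.continuous_det.comp
      (by fun_prop : Continuous fun A : E →L[ℝ] E => 1 + t • A)).measurable.comp
        (measurable_fderiv ℝ g)
  obtain ⟨B, hB⟩ := (isCompact_closedBall (0 : E →L[ℝ] E) L).exists_bound_of_continuousOn
    (f := fun A : E →L[ℝ] E => (1 + t • A).det)
    (ContinuousLinearMap.continuous_det.comp (by fun_prop)).continuousOn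
  refine Measure.integrableOn_of_bounded (M := B) measure_closedBall_lt_top.ne
    hmeas.aestronglyMeasurable (.of_forall fun x => hB _ ?_)
  simpa using norm_fderiv_le_of_lipschitz ℝ hg

theorem LipschitzWith.setIntegral_det_one_add_smul_fderiv_of_lt (μ : Measure E)
    [μ.IsAddHaarMeasure] (hg : LipschitzWith L g) (hout : ∀ x, R < ‖x‖ → g x = 0)
    {t : ℝ≥0} (ht : t * L < 1) :
    ∫ x in closedBall 0 R, (1 + (t : ℝ) • fderiv ℝ g x).det ∂μ = μ.real (closedBall 0 R) := by
  set f : E → E := fun x => x + (t : ℝ) • g x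
  set D : Set E := {x | DifferentiableAt ℝ g x}
  have hD : MeasurableSet D := measurableSet_of_differentiableAt ℝ g
  have hDnull : μ Dᶜ = 0 := hg.ae_differentiableAt
  have hf : LipschitzWith (1 + t * L) f := by
    refine LipschitzWith.id.add (LipschitzWith.of_dist_le_mul fun x y => ?_)
    rw [dist_smul₀, NNReal.norm_eq, NNReal.coe_mul, mul_assoc]
    exact mul_le_mul_of_nonneg_left (hg.dist_le_mul x y) t.2
  have hcov := lintegral_abs_det_fderiv_eq_addHaar_image μ
    (s := closedBall 0 R ∩ D) (f := f) (f' := fun x => 1 + (t : ℝ) • fderiv ℝ g x)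
    (isClosed_closedBall.measurableSet.inter hD)
    (fun x hx => ((hasFDerivAt_id x).add
      (hx.2.hasFDerivAt.const_smul (t : ℝ))).hasFDerivWithinAt)
    (hg.bijective_add_smul ht).1.injOn
  have himg : μ (f '' (closedBall 0 R ∩ D)) = μ (closedBall 0 R) := by
    apply le_antisymm
    · conv_rhs => rw [← hg.add_smul_image_closedBall hout ht]
      exact measure_mono (image_mono inter_subset_left)
    · calc μ (closedBall 0 R) = μ (f '' closedBall 0 R) := by
            rw [hg.add_smul_image_closedBall hout ht]
        _ ≤ μ (f '' (closedBall 0 R ∩ D) ∪ f '' Dᶜ) := by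
            refine measure_mono ?_
            rw [← image_union]
            exact image_mono fun x hx => by by_cases h : x ∈ D <;> simp [hx, h]
        _ ≤ μ (f '' (closedBall 0 R ∩ D)) + μ (f '' Dᶜ) := measure_union_le _ _
        _ = _ := by rw [hf.addHaar_image_eq_zero μ hDnull, add_zero]
  have hpos : ∀ x, 0 ≤ (1 + (t : ℝ) • fderiv ℝ g x).det := fun x => by
    refine (ContinuousLinearMap.det_one_add_pos_of_norm_lt_one ?_).le
    rw [norm_smul, NNReal.norm_eq]
    exact (mul_le_mul_of_nonneg_left (norm_fderiv_le_of_lipschitz ℝ hg) t.2).trans_lt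
      (by exact_mod_cast ht)
  have hint := hg.integrableOn_det_one_add_smul_fderiv (R := R) μ t
  rw [integral_eq_lintegral_of_nonneg_ae (.of_forall hpos) hint.1, Measure.real, ← himg, ← hcov]
  congr 1
  have hae : (closedBall 0 R ∩ D : Set E) =ᵐ[μ] closedBall 0 R :=
    inter_ae_eq_left_of_ae_eq_univ (by simpa [ae_eq_univ] using hDnull)
  rw [setLIntegral_congr hae]
  simp_rw [abs_of_nonneg (hpos _)]

theorem LipschitzWith.setIntegral_det_one_add_fderiv (μ : Measure E)
    [μ.IsAddHaarMeasure] (hg : LipschitzWith L g) (hout : ∀ x, R < ‖x‖ → g x = 0) :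
    ∫ x in closedBall 0 R, (1 + fderiv ℝ g x).det ∂μ = μ.real (closedBall 0 R) := by
  -- The bound `1 / (L + 1)` makes `t i * L < 1` at every node, even when `L = 0`.
  obtain ⟨t, w, ht, hw⟩ := exists_extrapolation_weights (finrank ℝ E)
    (ε := 1 / (L + 1)) (by positivity)
  have hdet : ∀ A : E →L[ℝ] E, (1 + A).det =
      ∑ i ∈ Finset.range (finrank ℝ E + 1), w i * (1 + t i • A).det := fun A => by
    obtain ⟨p, hp, hpe⟩ := A.exists_polynomial_eval_eq_det_one_add_smul
    have := hw p hp
    simpa [hpe] using this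
  have hone : ∑ i ∈ Finset.range (finrank ℝ E + 1), w i = 1 := by
    simpa using (hw 1 (by simp)).symm
  rw [setIntegral_congr_fun isClosed_closedBall.measurableSet
    fun x _ => hdet (fderiv ℝ g x), integral_finsetSum _ fun i _ =>
    (hg.integrableOn_det_one_add_smul_fderiv μ (t i)).const_mul (w i)]
  simp_rw [integral_const_mul]
  have hsmall : ∀ i, ∫ x in closedBall 0 R, (1 + t i • fderiv ℝ g x).det ∂μ =
      μ.real (closedBall 0 R) := fun i => by
    obtain ⟨s, hs⟩ : ∃ s : ℝ≥0, (s : ℝ) = t i := ⟨⟨t i, (ht i).1.le⟩, rfl⟩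
    have hlt : s * L < 1 := by
      rw [← NNReal.coe_lt_coe]
      push_cast [hs]
      calc t i * (L : ℝ) ≤ 1 / (L + 1) * L := mul_le_mul_of_nonneg_right (ht i).2 L.2
        _ < 1 := by
          rw [one_div, inv_mul_lt_iff₀ (by positivity)]
          linarith
    exact hs ▸ hg.setIntegral_det_one_add_smul_fderiv_of_lt μ hout hlt
  simp_rw [hsmall]
  rw [← Finset.sum_mul, hone, one_mul]

end Perturbation

end JacobianOfLipschitzPerturbation

/-! ### Brouwer's theorem and variational inequalities, Lipschitz case -/

section LipschitzFixedPoint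

open Metric Set Module
open scoped NNReal ENNReal RealInnerProductSpace

variable {E : Type*} [NormedAddCommGroup E] [InnerProductSpace ℝ E]

/-- Differentiating `‖r y‖ ^ 2 = c ^ 2` shows that the range of `r'` is orthogonal to the nonzero
vector `r x`. -/
theorem ContinuousLinearMap.det_eq_zero_of_eventually_norm_eq [FiniteDimensional ℝ E]
    {r : E → E} {r' : E →L[ℝ] E} {x : E}
    (hr : HasFDerivAt r r' x) {c : ℝ} (hc : 0 < c) (h : ∀ᶠ y in nhds x, ‖r y‖ = c) :
    r'.det = 0 := by
  have h1 : HasFDerivAt (fun y => ‖r y‖ ^ 2) (2 • (innerSL ℝ (r x)).comp r') x := hr.norm_sq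
  have h2 : HasFDerivAt (fun y => ‖r y‖ ^ 2) (0 : E →L[ℝ] ℝ) x :=
    (hasFDerivAt_const (c ^ 2) x).congr_of_eventuallyEq (h.mono fun y hy => by simp [hy])
  have h3 := h1.unique h2
  by_contra hdet
  have hu : IsUnit (r' : E →ₗ[ℝ] E) :=
    (LinearMap.isUnit_iff_isUnit_det _).2 (isUnit_iff_ne_zero.2 hdet)
  obtain ⟨v, hv⟩ := ((Module.End.isUnit_iff _).1 hu).2 (r x)
  have h4 := congrArg (fun A : E →L[ℝ] ℝ => A v) h3
  have hv' : r' v = r x := hv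
  simp [hv', h.self_of_nhds, hc.ne'] at h4

/-- There is no Lipschitz retraction of the space onto the complement of an open ball. -/
theorem LipschitzWith.exists_norm_ne_of_eq_self [FiniteDimensional ℝ E] {r : E → E} {C : ℝ≥0}
    (hr : LipschitzWith C r) {R : ℝ} (hR : 0 < R) (hout : ∀ x, R < ‖x‖ → r x = x) :
    ∃ x, ‖x‖ ≤ R ∧ ‖r x‖ ≠ R := by
  by_contra! hball
  borelize E
  set μ : Measure E := Measure.hausdorffMeasure (finrank ℝ E)
  set g : E → E := fun x => r x - x
  have hg : LipschitzWith (C + 1) g := hr.sub LipschitzWith.id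
  have hint := hg.setIntegral_det_one_add_fderiv (R := R) μ fun x hx => by simp [g, hout x hx]
  have hzero : ∀ᵐ x ∂μ, x ∈ closedBall (0 : E) R → (1 + fderiv ℝ g x).det = 0 := by
    have hsph : ∀ᵐ x ∂μ, x ∉ sphere (0 : E) R :=
      measure_eq_zero_iff_ae_notMem.1 (Measure.addHaar_sphere_of_ne_zero μ 0 hR.ne')
    filter_upwards [hg.ae_differentiableAt (μ := μ), hsph] with x hd hs hx
    have hx' : x ∈ ball (0 : E) R := by
      simp only [mem_closedBall_zero_iff, mem_sphere_zero_iff_norm, mem_ball_zero_iff] at *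
      exact lt_of_le_of_ne hx hs
    have hder : HasFDerivAt r (1 + fderiv ℝ g x) x := by
      refine ((hasFDerivAt_id x).add hd.hasFDerivAt).congr_of_eventuallyEq (.of_forall fun y => ?_)
      simp [g]
    refine ContinuousLinearMap.det_eq_zero_of_eventually_norm_eq hder hR ?_
    filter_upwards [isOpen_ball.mem_nhds hx'] with y hy
    exact hball y (mem_ball_zero_iff.1 hy).le
  rw [setIntegral_eq_zero_of_ae_eq_zero hzero] at hint
  have : 0 < μ.real (closedBall (0 : E) R) :=
    ENNReal.toReal_pos (measure_closedBall_pos μ 0 hR).ne' measure_closedBall_lt_top.ne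
  linarith

theorem norm_inv_smul_sub_inv_smul_mul_le (y z : E) (hy : y ≠ 0) (hz : z ≠ 0) :
    ‖(‖y‖⁻¹ • y - ‖z‖⁻¹ • z)‖ * ‖z‖ ≤ 2 * ‖y - z‖ := by
  have hy' : 0 < ‖y‖ := norm_pos_iff.2 hy
  have hz' : 0 < ‖z‖ := norm_pos_iff.2 hz
  have h1 : ‖z‖ • (‖y‖⁻¹ • y - ‖z‖⁻¹ • z) = ((‖z‖ - ‖y‖) * ‖y‖⁻¹) • y + (y - z) := by
    rw [smul_sub, smul_smul, smul_smul, mul_inv_cancel₀ hz'.ne', sub_mul,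
      mul_inv_cancel₀ hy'.ne', sub_smul]
    simp
  calc ‖(‖y‖⁻¹ • y - ‖z‖⁻¹ • z)‖ * ‖z‖ = ‖(‖z‖ • (‖y‖⁻¹ • y - ‖z‖⁻¹ • z))‖ := by
        rw [norm_smul, norm_norm, mul_comm]
    _ ≤ ‖((‖z‖ - ‖y‖) * ‖y‖⁻¹) • y‖ + ‖y - z‖ := by rw [h1]; exact norm_add_le _ _
    _ = |‖y‖ - ‖z‖| + ‖y - z‖ := by
        rw [norm_smul, norm_mul, norm_inv, norm_norm, mul_assoc, inv_mul_cancel₀ hy'.ne', mul_one,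
          Real.norm_eq_abs, abs_sub_comm]
    _ ≤ 2 * ‖y - z‖ := by linarith [abs_norm_sub_norm_le y z]

/-- Pushing vectors out of the ball of radius `R` is Lipschitz away from the origin. -/
theorem lipschitzOnWith_max_norm_smul_normalize {R c : ℝ} (hR : 0 ≤ R) (hc : 0 < c) :
    LipschitzOnWith (3 + 2 * R / c).toNNReal
      (fun y : E => max R ‖y‖ • (‖y‖⁻¹ • y)) {y | c ≤ ‖y‖} := by
  refine LipschitzOnWith.of_dist_le_mul fun y hy z hz => ?_
  rw [Real.coe_toNNReal _ (by positivity), dist_eq_norm, dist_eq_norm]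
  simp only [mem_ofPred_eq] at hy hz
  have hy0 : y ≠ 0 := norm_pos_iff.1 (hc.trans_le hy)
  have hz0 : z ≠ 0 := norm_pos_iff.1 (hc.trans_le hz)
  have hU := norm_inv_smul_sub_inv_smul_mul_le y z hy0 hz0
  set u := ‖y‖⁻¹ • y
  set v := ‖z‖⁻¹ • z
  have hu : ‖u‖ = 1 := by simp [u, norm_smul, hy0]
  have h1 : max R ‖y‖ • u - max R ‖z‖ • v = (max R ‖y‖ - max R ‖z‖) • u + max R ‖z‖ • (u - v) := by
    rw [sub_smul, smul_sub]; abel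
  have h2 : |max R ‖y‖ - max R ‖z‖| ≤ ‖y - z‖ :=
    (abs_max_sub_max_le_max _ _ _ _).trans (by simpa using abs_norm_sub_norm_le y z)
  have h3 : max R ‖z‖ ≤ (R / c + 1) * ‖z‖ := by
    have : R ≤ R / c * ‖z‖ := by
      rw [div_mul_eq_mul_div, le_div_iff₀ hc]
      exact mul_le_mul_of_nonneg_left hz hR
    have := norm_nonneg z
    apply max_le <;> nlinarith [div_nonneg hR hc.le]
  calc ‖max R ‖y‖ • u - max R ‖z‖ • v‖
      ≤ |max R ‖y‖ - max R ‖z‖| * ‖u‖ + max R ‖z‖ * ‖u - v‖ := by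
        rw [h1]
        refine (norm_add_le _ _).trans_eq ?_
        rw [norm_smul _ u, norm_smul _ (u - v), Real.norm_eq_abs,
          Real.norm_of_nonneg (le_max_of_le_left hR)]
    _ ≤ ‖y - z‖ + (R / c + 1) * (‖u - v‖ * ‖z‖) := by
        rw [hu, mul_one]
        have := mul_le_mul_of_nonneg_right h3 (norm_nonneg (u - v))
        linarith
    _ ≤ ‖y - z‖ + (R / c + 1) * (2 * ‖y - z‖) := by
        gcongr
    _ = (3 + 2 * R / c) * ‖y - z‖ := by ring

/-- Brouwer's fixed point theorem for bounded Lipschitz maps. -/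
theorem LipschitzWith.exists_fixedPoint_of_norm_le [FiniteDimensional ℝ E] {f : E → E} {L : ℝ≥0}
    (hf : LipschitzWith L f) {R : ℝ} (hR : 0 < R) (hb : ∀ x, ‖f x‖ ≤ R) : ∃ x, f x = x := by
  by_contra! hne
  -- The cutoff makes `x - χ x • f x` the identity beyond `2 * R` without creating zeros: a zero
  -- would have norm at most `R`, where `χ = 1`.
  set χ : E → ℝ := fun x => max 0 (min 1 (2 - ‖x‖ / R)) with hχ
  have hχ0 : ∀ x, 0 ≤ χ x := fun x => le_max_left _ _
  have hχ1 : ∀ x, χ x ≤ 1 := fun x => max_le zero_le_one (min_le_left _ _)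
  have hχin : ∀ x, ‖x‖ ≤ R → χ x = 1 := fun x hx => by
    have : ‖x‖ / R ≤ 1 := (div_le_one hR).2 hx
    simp only [χ]
    rw [min_eq_left (by linarith), max_eq_right zero_le_one]
  have hχout : ∀ x, 2 * R ≤ ‖x‖ → χ x = 0 := fun x hx => by
    have : 2 ≤ ‖x‖ / R := (le_div_iff₀ hR).2 hx
    exact max_eq_left ((min_le_right _ _).trans (by linarith))
  have hχL : ∀ x y, |χ x - χ y| ≤ ‖x - y‖ / R := fun x y => by
    have h1 : |χ x - χ y| ≤ |(2 - ‖x‖ / R) - (2 - ‖y‖ / R)| := by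
      refine (abs_max_sub_max_le_max _ _ _ _).trans ?_
      rw [sub_self, abs_zero, max_eq_right (abs_nonneg _)]
      refine (abs_min_sub_min_le_max _ _ _ _).trans ?_
      rw [sub_self, abs_zero, max_eq_right (abs_nonneg _)]
    refine h1.trans ?_
    rw [show (2 - ‖x‖ / R) - (2 - ‖y‖ / R) = -((‖x‖ - ‖y‖) / R) by ring, abs_neg, abs_div,
      abs_of_pos hR]
    gcongr
    exact abs_norm_sub_norm_le x y
  have hkL : LipschitzWith (L + 1) fun x => χ x • f x := by
    refine LipschitzWith.of_dist_le_mul fun x y => ?_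
    rw [dist_eq_norm, dist_eq_norm,
      show χ x • f x - χ y • f y = χ x • (f x - f y) + (χ x - χ y) • f y by
        rw [smul_sub, sub_smul]; abel]
    refine (norm_add_le _ _).trans ?_
    rw [norm_smul, norm_smul, Real.norm_of_nonneg (hχ0 x), Real.norm_eq_abs]
    have h1 := mul_le_mul (hχ1 x) (hf.norm_sub_le x y) (norm_nonneg _) zero_le_one
    have h2 := mul_le_mul (hχL x y) (hb y) (norm_nonneg _) (by positivity)
    rw [div_mul_cancel₀ _ hR.ne'] at h2
    push_cast
    linarith
  have hkb : ∀ x, ‖χ x • f x‖ ≤ R := fun x => by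
    rw [norm_smul, Real.norm_of_nonneg (hχ0 x)]
    simpa using mul_le_mul (hχ1 x) (hb x) (norm_nonneg _) zero_le_one
  set h : E → E := fun x => x - χ x • f x
  have hL : LipschitzWith (1 + (L + 1)) h := LipschitzWith.id.sub hkL
  have hout : ∀ x, 2 * R ≤ ‖x‖ → h x = x := fun x hx => by simp [h, hχout x hx]
  have hh0 : ∀ x, h x ≠ 0 := fun x hx => by
    have hx' : x = χ x • f x := sub_eq_zero.1 hx
    have hxR : ‖x‖ ≤ R := hx' ▸ hkb x
    rw [hχin x hxR, one_smul] at hx'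
    exact hne x hx'.symm
  obtain ⟨x₀, -, hx₀⟩ := (isCompact_closedBall (0 : E) (2 * R)).exists_isMinOn
    ⟨0, by simp [hR.le]⟩ hL.continuous.norm.continuousOn
  set c := min ‖h x₀‖ (2 * R)
  have hc : 0 < c := lt_min (norm_pos_iff.2 (hh0 x₀)) (by positivity)
  have hhc : ∀ x, c ≤ ‖h x‖ := fun x => by
    rcases le_total ‖x‖ (2 * R) with hx | hx
    · exact (min_le_left _ _).trans (hx₀ (mem_closedBall_zero_iff.2 hx))
    · rw [hout x hx]
      exact (min_le_right _ _).trans hx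
  -- On the ball of radius `3 * R` one has `‖h x‖ ≤ 3 * R`, so `r` lands on the sphere; outside it
  -- `r` is the identity.
  set r : E → E := fun x => max (3 * R) ‖h x‖ • (‖h x‖⁻¹ • h x)
  have hrL : LipschitzWith ((3 + 2 * (3 * R) / c).toNNReal * (1 + (L + 1))) r :=
    lipschitzOnWith_univ.1 <| (lipschitzOnWith_max_norm_smul_normalize (by positivity) hc).comp
      hL.lipschitzOnWith fun x _ => hhc x
  obtain ⟨x, hx, hrx⟩ := hrL.exists_norm_ne_of_eq_self (R := 3 * R) (by positivity) fun x hx => by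
    have hx0 : ‖x‖ ≠ 0 := by linarith
    simp only [r]
    rw [hout x (by linarith), max_eq_right hx.le, smul_smul, mul_inv_cancel₀ hx0, one_smul]
  apply hrx
  have hle : ‖h x‖ ≤ 3 * R := by
    rcases le_total ‖x‖ (2 * R) with hx2 | hx2
    · linarith [_root_.norm_sub_le x (χ x • f x), hkb x]
    · rwa [hout x hx2]
  simp only [r]
  rw [max_eq_left hle, norm_smul, norm_smul, norm_inv, norm_norm,
    inv_mul_cancel₀ (norm_ne_zero_iff.2 (hh0 x)), mul_one, Real.norm_of_nonneg (by positivity)]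

/-- Existence of solutions of variational inequalities for Lipschitz fields on compact
convex sets. -/
theorem IsCompact.exists_forall_inner_sub_nonpos [FiniteDimensional ℝ E] {K : Set E}
    (hK : IsCompact K) (hconv : Convex ℝ K) (hne : K.Nonempty) {F : E → E} {L : ℝ≥0}
    (hF : LipschitzWith L F) : ∃ z ∈ K, ∀ w ∈ K, ⟪F z, w - z⟫ ≤ 0 := by
  have hproj : ∀ u : E, ∃ v ∈ K, ∀ w ∈ K, ⟪u - v, w - v⟫ ≤ 0 := fun u => by
    obtain ⟨v, hv, hvu⟩ := exists_norm_eq_iInf_of_complete_convex hne hK.isComplete hconv u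
    exact ⟨v, hv, (norm_eq_iInf_iff_real_inner_le_zero hconv hv).1 hvu⟩
  choose P hPK hP using hproj
  have hPL : LipschitzWith 1 P := LipschitzWith.of_dist_le_mul fun u v => by
    rw [dist_eq_norm, dist_eq_norm, NNReal.coe_one, one_mul]
    have h1 := hP u (P v) (hPK v)
    have h2 := hP v (P u) (hPK u)
    -- Adding the two obtuse-angle inequalities shows that `P` is firmly nonexpansive.
    have h3 : ‖P u - P v‖ ^ 2 ≤ ⟪u - v, P u - P v⟫ := by
      have : ⟪u - v, P u - P v⟫ - ⟪P u - P v, P u - P v⟫ =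
          -⟪u - P u, P v - P u⟫ - ⟪v - P v, P u - P v⟫ := by
        simp only [inner_sub_left, inner_sub_right]; ring
      rw [real_inner_self_eq_norm_sq] at this
      linarith
    have h4 := h3.trans (real_inner_le_norm _ _)
    by_contra! hlt
    nlinarith [norm_nonneg (u - v)]
  obtain ⟨R, hR, hKR⟩ := hK.isBounded.exists_pos_norm_le
  have hfL : LipschitzWith (1 * (1 + L)) fun z => P (z + F z) :=
    hPL.comp (LipschitzWith.id.add hF)
  obtain ⟨z, hz⟩ := hfL.exists_fixedPoint_of_norm_le hR fun x => hKR _ (hPK _)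
  refine ⟨z, hz ▸ hPK _, fun w hw => ?_⟩
  have := hP (z + F z) w hw
  rwa [hz, add_sub_cancel_left] at this

end LipschitzFixedPoint

/-! ### Mixed equilibria of finite two-player games -/

section BimatrixGame

open LLMNash
open scoped RealInnerProductSpace

/-- Every finite two-player game has an equilibrium in mixed strategies. -/
theorem exists_mixed_equilibrium {X Y : Type*} [Fintype X] [Nonempty X] [Fintype Y] [Nonempty Y]
    (U V : X → Y → ℝ) :
    ∃ σ ∈ stdSimplex ℝ X, ∃ τ ∈ stdSimplex ℝ Y,
      (∀ σ' ∈ stdSimplex ℝ X, mixedPayoff U σ' τ ≤ mixedPayoff U σ τ) ∧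
      (∀ τ' ∈ stdSimplex ℝ Y, mixedPayoff V σ τ' ≤ mixedPayoff V σ τ) := by
  classical
  let F₀ : EuclideanSpace ℝ (X ⊕ Y) →ₗ[ℝ] EuclideanSpace ℝ (X ⊕ Y) :=
    { toFun := fun z => WithLp.toLp 2 <|
        Sum.elim (fun x => ∑ y, z (.inr y) * U x y) (fun y => ∑ x, z (.inl x) * V x y)
      map_add' := fun z w => by
        ext (x | y) <;> simp [add_mul, Finset.sum_add_distrib]
      map_smul' := fun c z => by
        ext (x | y) <;> simp [Finset.mul_sum, mul_assoc] }
  let F := LinearMap.toContinuousLinearMap F₀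
  let ι : (X → ℝ) × (Y → ℝ) → EuclideanSpace ℝ (X ⊕ Y) :=
    fun p => WithLp.toLp 2 (Sum.elim p.1 p.2)
  have hιc : Continuous ι := by
    refine (PiLp.continuous_toLp 2 _).comp (continuous_pi fun i => ?_)
    rcases i with x | y <;> simp <;> fun_prop
  have hιl : IsLinearMap ℝ ι :=
    ⟨fun p q => by ext (x | y) <;> simp [ι], fun c p => by ext (x | y) <;> simp [ι]⟩
  have hne : (stdSimplex ℝ X ×ˢ stdSimplex ℝ Y).Nonempty :=
    ⟨(Pi.single (Classical.arbitrary X) 1, Pi.single (Classical.arbitrary Y) 1),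
      single_mem_stdSimplex ℝ _, single_mem_stdSimplex ℝ _⟩
  obtain ⟨_, ⟨⟨σ, τ⟩, ⟨hσ, hτ⟩, rfl⟩, hVI⟩ :=
    (((isCompact_stdSimplex ℝ X).prod
      (isCompact_stdSimplex ℝ Y)).image hιc).exists_forall_inner_sub_nonpos
      (((convex_stdSimplex ℝ X).prod (convex_stdSimplex ℝ Y)).is_linear_image hιl)
      (hne.image ι) F.lipschitz
  have hinner : ∀ σ' τ', ⟪F (ι (σ, τ)), ι (σ', τ') - ι (σ, τ)⟫ =
      (mixedPayoff U σ' τ - mixedPayoff U σ τ) + (mixedPayoff V σ τ' - mixedPayoff V σ τ) := by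
    intro σ' τ'
    have hV : ∀ τ'', mixedPayoff V σ τ'' = ∑ y, τ'' y * ∑ x, σ x * V x y := fun τ'' => by
      rw [mixedPayoff, Finset.sum_comm]
      simp only [Finset.mul_sum]
      exact Finset.sum_congr rfl fun y _ => Finset.sum_congr rfl fun x _ => by ring
    have hU : ∀ σ'', mixedPayoff U σ'' τ = ∑ x, σ'' x * ∑ y, τ y * U x y := fun σ'' => by
      simp only [mixedPayoff, Finset.mul_sum, mul_assoc]
    rw [hV, hV, hU, hU]
    simp [PiLp.inner_apply, F, F₀, ι, Fintype.sum_sum_type, sub_mul, Finset.sum_sub_distrib]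
    ring
  refine ⟨σ, hσ, τ, hτ, fun σ' hσ' => ?_, fun τ' hτ' => ?_⟩
  -- Keeping the opponent at `τ` cancels the other player's gain.
  · have := hVI _ ⟨(σ', τ), ⟨hσ', hτ⟩, rfl⟩
    rw [hinner] at this
    linarith
  · have := hVI _ ⟨(σ, τ'), ⟨hσ, hτ'⟩, rfl⟩
    rw [hinner] at this
    linarith

end BimatrixGame

theorem theorem1 {ActA ActD InfA InfD X Y Ξ : Type*}
    [MeasurableSpace ActA] [MeasurableSpace ActD]
    [Fintype X] [Nonempty X] [Fintype Y] [Nonempty Y]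
    (G : LLMNash.Game ActA ActD InfA InfD X Y Ξ)
    (iA : InfA) (iD : InfD) (θ δ : Ξ)
    (hG : G.HasExpectedUtilities iA iD θ δ) :
    ∃ (σ : X → ℝ) (τ : Y → ℝ), G.IsMixedReasoningEquilibrium iA iD θ δ σ τ := by
  obtain ⟨σ, hσ, τ, hτ, hA, hD⟩ :=
    exists_mixed_equilibrium (G.promptPayoffA iA iD θ δ) (G.promptPayoffD iA iD θ δ)
  exact ⟨σ, τ, hσ, hτ, hA, hD⟩
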